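/- Let $n,p\ge 0$ be integers and equip $\mathbb R^n$, $\mathbb R^p$, $\mathbb R^n\times\mathbb R^p$ with the Euclidean inner products. A set $\Omega$ in a finite-dimensional real space is nearly convex if there is a convex set $C$ with $C\subset\Omega\subset\overline C$; $\mathrm{ri}\,\Omega$ denotes the interior of $\Omega$ relative to its affine hull. A function $\varphi\colon X\to[-\infty,\infty]$ has effective domain $\mathrm{dom}\,\varphi=\{x\mid\varphi(x)<\infty\}$ and is nearly convex if its epigraph $\{(x,\lambda)\in X\times\mathbb R\mid\varphi(x)\le\lambda\}$ is nearly convex; it is proper if $\mathrm{dom}\,\varphi\ne\emptyset$ and $\varphi(x)>-\infty$ for all $x$. Its Fenchel conjugate is $\varphi^*(w)=\sup_{x\in X}\{\langle w,x\rangle-\varphi(x)\}$. A set-valued mapping $F\colon\mathbb R^n\rightrightarrows\mathbb R^p$ is nearly convex if its graph $\mathrm{gph}\,F=\{(x,y)\mid y\in F(x)\}$ is nearly convex, and its Fenchel conjugate is the support function of its graph, $$F^*(u,v)=\sup\{\langle u,x\rangle+\langle v,y\rangle\mid (x,y)\in\mathrm{gph}\,F\},\qquad (u,v)\in\mathbb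 R^n\times\mathbb R^p.$$ The infimal convolution of two functions $g,h$ is $(g\,\square\,h)(z)=\inf\{g(z_1)+h(z_2)\mid z_1+z_2=z\}$. Theorem. Let $f\colon\mathbb R^n\times\mathbb R^p\to[-\infty,\infty]$ be a proper nearly convex function and let $F\colon\mathbb R^n\rightrightarrows\mathbb R^p$ be a nearly convex set-valued mapping such that $$\mathrm{ri}(\mathrm{dom}\,f)\cap\mathrm{ri}(\mathrm{gph}\,F)\neq\emptyset .$$ Let $\mu(x)=\inf\{f(x,y)\mid y\in F(x)\}$ for $x\in\mathbb R^n$, with $\inf\emptyset=\infty$. Then $$\mu^*(w)=(f^*\,\square\,F^*)(w,0)\quad\text{for all } w\in\mathbb R^n .$$ In addition, for every $w\in\mathbb R^n$ with $\mu^*(w)\in\mathbb R$ there exist $w_1,w_2\in\mathbb R^n$ and $v\in\mathbb R^p$ such that $w_1+w_2=w$ and $$\mu^*(w)=f^*(w_1,v)+F^*(w_2,-v).$$ -/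

import Mathlib

noncomputable section

namespace NearConvexity

/-- The Euclidean space `ℝⁿ`. -/
abbrev Rn (n : ℕ) : Type := EuclideanSpace ℝ (Fin n)

/-- The Euclidean product space `ℝⁿ × ℝᵖ`, with `⟪(u, v), (x, y)⟫ = ⟪u, x⟫ + ⟪v, y⟫`. -/
abbrev RnRp (n p : ℕ) : Type := WithLp 2 (Rn n × Rn p)

/-- The point `(x, y)` of `ℝⁿ × ℝᵖ`. -/
abbrev pair {n p : ℕ} (x : Rn n) (y : Rn p) : RnRp n p := WithLp.toLp 2 (x, y)

/-- A set is nearly convex if it lies between a convex set and the closure of that convex set. -/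
def NearlyConvex {X : Type*} [AddCommGroup X] [Module ℝ X] [TopologicalSpace X]
    (s : Set X) : Prop :=
  ∃ C : Set X, Convex ℝ C ∧ C ⊆ s ∧ s ⊆ closure C

/-- The effective domain of an extended-real-valued function. -/
def effDom {X : Type*} (f : X → EReal) : Set X := {x | f x < ⊤}

/-- The epigraph of an extended-real-valued function, a subset of `X × ℝ`. -/
def epi {X : Type*} (f : X → EReal) : Set (X × ℝ) := {z | f z.1 ≤ (z.2 : EReal)}

/-- A function is proper if its effective domain is nonempty and it never takes the value `-∞`. -/
def ProperFun {X : Type*} (f : X → EReal) : Prop := (effDom f).Nonempty ∧ ∀ x, ⊥ < f x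

/-- A function is nearly convex if its epigraph is a nearly convex set. -/
def NearlyConvexFun {X : Type*} [AddCommGroup X] [Module ℝ X] [TopologicalSpace X]
    (f : X → EReal) : Prop :=
  NearlyConvex (epi f)

/-- The graph of a set-valued mapping from `ℝⁿ` to `ℝᵖ`. -/
def gph {n p : ℕ} (F : Rn n → Set (Rn p)) : Set (RnRp n p) := {z | z.snd ∈ F z.fst}

/-- A set-valued mapping is nearly convex if its graph is a nearly convex set. -/
def NearlyConvexMap {n p : ℕ} (F : Rn n → Set (Rn p)) : Prop := NearlyConvex (gph F)

/-- The optimal value function `μ x = inf {f (x, y) | y ∈ F x}`, where `inf ∅ = +∞`. -/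
def optVal {n p : ℕ} (f : RnRp n p → EReal) (F : Rn n → Set (Rn p)) (x : Rn n) : EReal :=
  ⨅ y ∈ F x, f (pair x y)

/-- The Fenchel conjugate `f* w = sup {⟪w, x⟫ - f x | x}`. -/
def conj {X : Type*} [NormedAddCommGroup X] [InnerProductSpace ℝ X]
    (f : X → EReal) (w : X) : EReal :=
  ⨆ x : X, ((inner ℝ w x : ℝ) : EReal) - f x

/-- The support function `σ_Ω v = sup {⟪v, x⟫ | x ∈ Ω}`. -/
def supportFun {X : Type*} [NormedAddCommGroup X] [InnerProductSpace ℝ X]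
    (Ω : Set X) (v : X) : EReal :=
  ⨆ x ∈ Ω, ((inner ℝ v x : ℝ) : EReal)

/-- The Fenchel conjugate of a set-valued mapping: the support function of its graph. -/
def mapConj {n p : ℕ} (F : Rn n → Set (Rn p)) : RnRp n p → EReal := supportFun (gph F)

/-- The infimal convolution `(g □ h) x = inf {g x₁ + h x₂ | x₁ + x₂ = x}`. It is meant for
functions that do not take the value `-∞`, so that no sum `∞ + (-∞)` occurs. -/
def infConv {X : Type*} [AddCommGroup X] (g h : X → EReal) (x : X) : EReal :=
  sInf {r : EReal | ∃ x₁ x₂ : X, x₁ + x₂ = x ∧ r = g x₁ + h x₂}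

end NearConvexity

end

/-! The number `μ*(w)` is the supremum of `⟨(w,0), z⟩ - f z` over `z ∈ gph F`, so every splitting
`(w,0) = a + b` bounds it by `f*(a) + F*(b)`, term by term. Equality needs an optimal splitting,
which separation supplies. Let `C ⊆ epi f` and `D ⊆ gph F` be convex with closures containing the
larger sets, and let `r = μ*(w)` be finite. The convex set of all `(c.1 - d, c.2 - ⟨w,c.1⟩ + r)`,
here with `w` standing for `(w,0)`, meets the vertical axis only at heights `≥ 0`. The common
relative interior point makes the cone over the differences `c.1 - d` a subspace, so a linear
functional lies below this set: the separating hyperplane is not vertical. The functional gives the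
splitting on `C × D`, and continuity extends the inequality to the closures. -/

open scoped Pointwise in
-- The prolongation of a segment past a relative interior point of `Ω` lands in the convex core `C`
-- itself, not only in `Ω`.
theorem exists_extension_mem_of_mem_intrinsicInterior {E : Type*} [NormedAddCommGroup E]
    [InnerProductSpace ℝ E] [FiniteDimensional ℝ E] {C Ω : Set E} (hC : Convex ℝ C)
    (hCΩ : C ⊆ Ω) (hΩ : Ω ⊆ closure C) {x : E} (hx : x ∈ intrinsicInterior ℝ Ω) {c : E}
    (hc : c ∈ C) : ∃ ε : ℝ, 0 < ε ∧ x + ε • (x - c) ∈ C := by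
  set S : Submodule ℝ E := (affineSpan ℝ Ω).direction with hS
  have hxΩ : x ∈ Ω := intrinsicInterior_subset hx
  have hsub : ∀ {y z}, y ∈ Ω → z ∈ Ω → y - z ∈ S := fun hy hz =>
    AffineSubspace.vsub_mem_direction (subset_affineSpan ℝ Ω hy) (subset_affineSpan ℝ Ω hz)
  obtain ⟨δ, hδ, hball⟩ : ∃ δ > 0, ∀ s ∈ S, ‖s‖ < δ → x + s ∈ Ω := by
    obtain ⟨y, hy, rfl⟩ := mem_intrinsicInterior.1 hx
    obtain ⟨δ, hδ, h⟩ := Metric.mem_nhds_iff.1 (mem_interior_iff_mem_nhds.1 hy)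
    refine ⟨δ, hδ, fun s hs hn => ?_⟩
    have hmem : (y : E) + s ∈ affineSpan ℝ Ω := by
      have := AffineSubspace.vadd_mem_of_mem_direction hs y.2
      rwa [vadd_eq_add, add_comm] at this
    have : (⟨(y : E) + s, hmem⟩ : affineSpan ℝ Ω) ∈ Metric.ball y δ := by
      rw [Metric.mem_ball, Subtype.dist_eq, dist_eq_norm]
      simpa using hn
    exact h this
  -- Thickening `C` by the orthogonal complement of its directions turns relative interiors into
  -- ordinary ones, where a convex set with nonempty interior has the same interior as its closure.
  set T : Set E := C + (Sᗮ : Set E) with hT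
  have hTc : Convex ℝ T := hC.add Sᗮ.convex
  have hxT : x ∈ interior (closure T) := by
    rw [mem_interior_iff_mem_nhds, Metric.mem_nhds_iff]
    refine ⟨δ, hδ, fun y hy => ?_⟩
    have hp : x + S.starProjection (y - x) ∈ Ω := by
      refine hball _ (S.starProjection_apply_mem _) (lt_of_le_of_lt ?_ (mem_ball_iff_norm.1 hy))
      exact S.norm_starProjection_apply_le _
    have hq : (y - x) - S.starProjection (y - x) ∈ Sᗮ := S.sub_starProjection_mem_orthogonal _
    have hcl : closure C + (Sᗮ : Set E) ⊆ closure T := by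
      rintro _ ⟨a, ha, b, hb, rfl⟩
      exact map_mem_closure (f := fun z => z + b) (by fun_prop) ha
        fun z hz => Set.add_mem_add hz hb
    have := hcl (Set.add_mem_add (hΩ hp) hq)
    convert this using 1
    abel
  have hTi : (interior T).Nonempty := by
    rw [hTc.interior_nonempty_iff_affineSpan_eq_top, eq_top_iff,
      ← isOpen_interior.affineSpan_eq_top ⟨x, hxT⟩, affineSpan_le]
    exact interior_subset.trans (closure_minimal (subset_affineSpan ℝ T)
      (AffineSubspace.closed_of_finiteDimensional _))
  rw [hTc.interior_closure_eq_interior_of_nonempty_interior hTi, mem_interior_iff_mem_nhds] at hxT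
  have hlim : Filter.Tendsto (fun ε : ℝ => x + ε • (x - c)) (nhdsWithin 0 (Set.Ioi 0)) (nhds x) := by
    have : Continuous fun ε : ℝ => x + ε • (x - c) := by fun_prop
    simpa using (this.tendsto 0).mono_left nhdsWithin_le_nhds
  obtain ⟨ε, hεT, hε⟩ := ((hlim.eventually hxT).and self_mem_nhdsWithin).exists
  obtain ⟨d, hd, t, ht, hdt⟩ := hεT
  refine ⟨ε, hε, ?_⟩
  -- The prolonged point stays in the affine hull, so its component in `Sᗮ` vanishes.
  have htS : t ∈ S := by
    have : t = ε • (x - c) + (x - d) := by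
      have hdt' : d + t = x + ε • (x - c) := hdt
      rw [eq_sub_of_add_eq' hdt']; abel
    rw [this]
    exact S.add_mem (S.smul_mem _ (hsub hxΩ (hCΩ hc))) (hsub hxΩ (hCΩ hd))
  have ht0 : t = 0 := by
    have := Submodule.inner_right_of_mem_orthogonal htS ht
    exact inner_self_eq_zero.1 this
  have hdt' : d + t = x + ε • (x - c) := hdt
  rw [← hdt', ht0, add_zero]
  exact hd

/-- Absorption makes the cone over the projection of `K` a whole subspace `L`. The height functional
on the vertical axis then extends positively to the cone over `K` by the M. Riesz theorem, without
topology. -/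
theorem exists_linearMap_le_of_absorbing {E : Type*} [AddCommGroup E] [Module ℝ E]
    {K : Set (E × ℝ)} (hK : Convex ℝ K) (hne : K.Nonempty)
    (h0 : ∀ k ∈ K, k.1 = 0 → 0 ≤ k.2)
    (habs : ∀ k ∈ K, ∃ t : ℝ, 0 < t ∧ ∃ k' ∈ K, k'.1 = -(t • k.1)) :
    ∃ a : E →ₗ[ℝ] ℝ, ∀ k ∈ K, a k.1 ≤ k.2 := by
  obtain ⟨k₀, hk₀⟩ := hne
  set L : Submodule ℝ E := Submodule.span ℝ (Prod.fst '' K) with hL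
  obtain ⟨M, hLM⟩ := Submodule.exists_isCompl L
  have hcone : ∀ {t t' : ℝ} {k k' : E × ℝ}, 0 ≤ t → 0 ≤ t' → k ∈ K → k' ∈ K →
      ∃ s : ℝ, 0 ≤ s ∧ ∃ q ∈ K, t • k + t' • k' = s • q := by
    intro t t' k k' ht ht' hk hk'
    rcases (add_nonneg ht ht').eq_or_lt with h | h
    · refine ⟨0, le_rfl, k, hk, ?_⟩
      rw [show t = 0 by linarith, show t' = 0 by linarith]
      simp
    · refine ⟨t + t', h.le, (t / (t + t')) • k + (t' / (t + t')) • k',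
        hK hk hk' (by positivity) (by positivity) (by field_simp), ?_⟩
      rw [smul_add, smul_smul, smul_smul, mul_div_cancel₀ _ h.ne', mul_div_cancel₀ _ h.ne']
  have hspan : ∀ l ∈ L, ∃ t : ℝ, 0 ≤ t ∧ ∃ k ∈ K, l = t • k.1 := by
    intro l hl
    induction hl using Submodule.span_induction with
    | mem x hx =>
      obtain ⟨k, hk, rfl⟩ := hx
      exact ⟨1, zero_le_one, k, hk, by simp⟩
    | zero => exact ⟨0, le_rfl, k₀, hk₀, by simp⟩
    | add x y _ _ ihx ihy =>
      obtain ⟨t, ht, k, hk, rfl⟩ := ihx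
      obtain ⟨t', ht', k', hk', rfl⟩ := ihy
      obtain ⟨s, hs, q, hq, h⟩ := hcone ht ht' hk hk'
      exact ⟨s, hs, q, hq, congrArg Prod.fst h⟩
    | smul r x _ ih =>
      obtain ⟨t, ht, k, hk, rfl⟩ := ih
      rcases le_total 0 r with hr | hr
      · exact ⟨r * t, mul_nonneg hr ht, k, hk, smul_smul _ _ _⟩
      · obtain ⟨u, hu, k', hk', hkk⟩ := habs k hk
        refine ⟨-r * t / u, div_nonneg (mul_nonneg (neg_nonneg.2 hr) ht) hu.le, k', hk', ?_⟩
        rw [hkk, smul_neg, smul_smul, smul_smul, ← neg_smul]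
        congr 1
        field_simp
  -- Adding a complement `M` of `L` lets every vector be moved vertically into the cone, as Riesz
  -- extension requires.
  let s : PointedCone ℝ (E × ℝ) :=
    { carrier := {q | ∃ m ∈ M, ∃ t : ℝ, 0 ≤ t ∧ ∃ k ∈ K, q = (m, 0) + t • k}
      zero_mem' := ⟨0, M.zero_mem, 0, le_rfl, k₀, hk₀, by simp; rfl⟩
      add_mem' := by
        rintro _ _ ⟨m, hm, t, ht, k, hk, rfl⟩ ⟨m', hm', t', ht', k', hk', rfl⟩
        obtain ⟨s, hs, q, hq, h⟩ := hcone ht ht' hk hk'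
        refine ⟨m + m', M.add_mem hm hm', s, hs, q, hq, ?_⟩
        rw [← h, add_add_add_comm]
        simp
      smul_mem' := by
        rintro ⟨c, hc⟩ _ ⟨m, hm, t, ht, k, hk, rfl⟩
        refine ⟨c • m, M.smul_mem c hm, c * t, mul_nonneg hc ht, k, hk, ?_⟩
        change c • ((m, (0 : ℝ)) + t • k) = _
        rw [smul_add, smul_smul]
        simp }
  let φ : (E × ℝ) →ₗ.[ℝ] ℝ :=
    { domain := LinearMap.ker (LinearMap.fst ℝ E ℝ)
      toFun := (LinearMap.snd ℝ E ℝ).comp (Submodule.subtype _) }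
  obtain ⟨g, hg, hgs⟩ := riesz_extension s φ
    (by
      rintro ⟨⟨u, c⟩, hu⟩ ⟨m, hm, t, ht, k, hk, h⟩
      have hu0 : u = 0 := by simpa [φ] using hu
      change 0 ≤ c
      have h1 : u = m + t • k.1 := congrArg Prod.fst h
      have h2 : c = 0 + t • k.2 := congrArg Prod.snd h
      have hkL : k.1 ∈ L := Submodule.subset_span ⟨k, hk, rfl⟩
      have htk : t • k.1 = 0 := by
        refine Submodule.disjoint_def.1 hLM.disjoint _ (L.smul_mem _ hkL) ?_
        rw [show t • k.1 = -m by rw [eq_neg_iff_add_eq_zero, add_comm, ← h1, hu0]]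
        exact M.neg_mem hm
      rw [h2, zero_add]
      rcases smul_eq_zero.1 htk with h | h
      · simp [h]
      · exact mul_nonneg ht (h0 k hk h))
    (by
      rintro ⟨u, c⟩
      obtain ⟨l, hl, m, hm, rfl⟩ := Submodule.mem_sup.1
        (show u ∈ L ⊔ M by rw [hLM.sup_eq_top]; trivial)
      obtain ⟨t, ht, k, hk, rfl⟩ := hspan l hl
      refine ⟨⟨(0, t * k.2 - c), by simp [φ]⟩, m, hm, t, ht, k, hk, ?_⟩
      ext <;> simp [add_comm])
  refine ⟨-(g.comp (LinearMap.inl ℝ E ℝ)), fun k hk => ?_⟩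
  have h1 : 0 ≤ g k := hgs k ⟨0, M.zero_mem, 1, zero_le_one, k, hk, by
    rw [one_smul]; ext <;> simp⟩
  have h2 : g (0, k.2) = k.2 := hg ⟨(0, k.2), by simp [φ]⟩
  have h3 : g k = g (k.1, 0) + g (0, k.2) := by rw [← map_add]; simp
  simp only [LinearMap.neg_apply, LinearMap.comp_apply, LinearMap.inl_apply]
  linarith

/-! ### Fenchel duality on a nearly convex set -/

namespace NearConvexity

theorem bot_lt_supportFun {X : Type*} [NormedAddCommGroup X] [InnerProductSpace ℝ X] {Ω : Set X}
    (hΩ : Ω.Nonempty) (v : X) : ⊥ < supportFun Ω v := by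
  obtain ⟨x, hx⟩ := hΩ
  exact (EReal.bot_lt_coe _).trans_le
    (le_iSup₂ (f := fun x (_ : x ∈ Ω) => ((inner ℝ v x : ℝ) : EReal)) x hx)

/-- The two suprema are taken one at a time. A point of `dom f` and a point of `G` make the support
function finite, so it can be subtracted from `r`. -/
theorem conj_add_supportFun_le {X : Type*} [NormedAddCommGroup X] [InnerProductSpace ℝ X]
    {f : X → EReal} (hf : ProperFun f) {G : Set X} (hG : G.Nonempty) {a b : X} {r : ℝ}
    (h : ∀ q ∈ epi f, ∀ z ∈ G, inner ℝ a q.1 - q.2 + inner ℝ b z ≤ r) :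
    conj f a + supportFun G b ≤ r := by
  have hσ : ∀ q ∈ epi f, supportFun G b ≤ ((r - (inner ℝ a q.1 - q.2) : ℝ) : EReal) :=
    fun q hq => iSup₂_le fun z hz => EReal.coe_le_coe_iff.2 (by linarith [h q hq z hz])
  obtain ⟨x₀, hx₀⟩ := hf.1
  have hx₀' : f x₀ < ⊤ := hx₀
  have hq₀ : (x₀, (f x₀).toReal) ∈ epi f := EReal.le_coe_toReal hx₀'.ne
  have htop : supportFun G b ≠ ⊤ := ((hσ _ hq₀).trans_lt (EReal.coe_lt_top _)).ne
  have hbot := (bot_lt_supportFun hG b).ne'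
  lift supportFun G b to ℝ using ⟨htop, hbot⟩ with σ
  have hc : conj f a ≤ ((r - σ : ℝ) : EReal) := by
    refine iSup_le fun x => ?_
    by_cases hx : f x = ⊤
    · simp [hx]
    · have hq : (x, (f x).toReal) ∈ epi f := EReal.le_coe_toReal hx
      have := EReal.coe_le_coe_iff.1 (hσ _ hq)
      rw [← EReal.coe_toReal hx (hf.2 x).ne', ← EReal.coe_sub, EReal.coe_le_coe_iff]
      dsimp only at this
      linarith
  calc conj f a + (σ : EReal) ≤ ((r - σ : ℝ) : EReal) + (σ : EReal) := by gcongr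
    _ = r := by rw [← EReal.coe_add]; simp

/-- Fenchel duality for the sum of a nearly convex function and the indicator of a nearly convex
set, with attainment of the dual problem. -/
theorem exists_conj_add_supportFun_le {X : Type*} [NormedAddCommGroup X] [InnerProductSpace ℝ X]
    [FiniteDimensional ℝ X] {f : X → EReal} (hp : ProperFun f) (hf : NearlyConvexFun f)
    {G : Set X} (hG : NearlyConvex G)
    (hqc : (intrinsicInterior ℝ (effDom f) ∩ intrinsicInterior ℝ G).Nonempty) {w : X} {r : ℝ}
    (hr : ∀ z ∈ G, ((inner ℝ w z : ℝ) : EReal) - f z ≤ r) :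
    ∃ a b : X, a + b = w ∧ conj f a + supportFun G b ≤ r := by
  obtain ⟨x, hxf, hxG⟩ := hqc
  obtain ⟨C, hC, hCf, hfC⟩ := hf
  obtain ⟨D, hD, hDG, hGD⟩ := hG
  have hGne : G.Nonempty := ⟨x, intrinsicInterior_subset hxG⟩
  have hCne : C.Nonempty := by
    obtain ⟨x₀, hx₀⟩ := hp.1
    have hx₀' : f x₀ < ⊤ := hx₀
    exact closure_nonempty_iff.1 ⟨(x₀, (f x₀).toReal), hfC (EReal.le_coe_toReal hx₀'.ne)⟩
  have hDne : D.Nonempty := closure_nonempty_iff.1 (hGne.mono hGD)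
  have hC₁ : Convex ℝ (Prod.fst '' C) := hC.linear_image (LinearMap.fst ℝ X ℝ)
  have hC₁f : Prod.fst '' C ⊆ effDom f := by
    rintro _ ⟨q, hq, rfl⟩
    have h : f q.1 ≤ (q.2 : EReal) := hCf hq
    exact h.trans_lt (EReal.coe_lt_top _)
  have hfC₁ : effDom f ⊆ closure (Prod.fst '' C) := by
    intro y hy
    have hy' : f y < ⊤ := hy
    exact image_closure_subset_closure_image continuous_fst
      ⟨(y, (f y).toReal), hfC (EReal.le_coe_toReal hy'.ne), rfl⟩
  have habs : ∀ c ∈ C, ∀ d ∈ D, ∃ t : ℝ, 0 < t ∧ ∃ c' ∈ C, ∃ d' ∈ D,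
      c'.1 - d' = -(t • (c.1 - d)) := by
    intro c hc d hd
    obtain ⟨s, hs, hsC⟩ := exists_extension_mem_of_mem_intrinsicInterior hC₁ hC₁f hfC₁ hxf
      (Set.mem_image_of_mem _ hc)
    obtain ⟨t, ht, htD⟩ := exists_extension_mem_of_mem_intrinsicInterior hD hDG hGD hxG hd
    -- Convexity shortens both prolongations to a common length, after which `x` cancels from the
    -- difference.
    have key : ∀ {A : Set X} {y : X} {e m : ℝ}, Convex ℝ A → y ∈ A → 0 < m → m ≤ e →
        x + e • (x - y) ∈ A → x + m • (x - y) ∈ A := by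
      intro A y e m hA hy hm hme he
      have he0 : 0 < e := hm.trans_le hme
      have := hA hy he (a := (e - m) / (1 + e)) (b := (1 + m) / (1 + e))
        (div_nonneg (by linarith) (by linarith)) (by positivity) (by field_simp; ring)
      convert this using 1
      match_scalars <;> field_simp; ring
    have hm : 0 < min s t := lt_min hs ht
    obtain ⟨c', hc', hcc⟩ := key hC₁ (Set.mem_image_of_mem _ hc) hm (min_le_left _ _) hsC
    refine ⟨min s t, hm, c', hc', _, key hD hd hm (min_le_right _ _) htD, ?_⟩
    rw [hcc]
    module
  -- On the vertical axis `c.1 = d` lies in `G`, and `hr` says exactly that the height is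
  -- nonnegative.
  let K : Set (X × ℝ) := {k | ∃ c ∈ C, ∃ d ∈ D, k = (c.1 - d, c.2 - inner ℝ w c.1 + r)}
  have hK : Convex ℝ K := by
    rintro _ ⟨c, hc, d, hd, rfl⟩ _ ⟨c', hc', d', hd', rfl⟩ s t hs ht hst
    refine ⟨_, hC hc hc' hs ht hst, _, hD hd hd' hs ht hst, ?_⟩
    ext
    · simp only [Prod.fst_add, Prod.smul_fst]
      module
    · simp only [Prod.snd_add, Prod.smul_snd, Prod.fst_add, Prod.smul_fst, smul_eq_mul,
        inner_add_right, inner_smul_right]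
      linear_combination r * hst
  obtain ⟨a, ha⟩ := exists_linearMap_le_of_absorbing hK
    (by
      obtain ⟨c, hc⟩ := hCne
      obtain ⟨d, hd⟩ := hDne
      exact ⟨_, c, hc, d, hd, rfl⟩)
    (by
      rintro _ ⟨c, hc, d, hd, rfl⟩ h
      have hcd : c.1 = d := sub_eq_zero.1 h
      have h1 := hr c.1 (hcd ▸ hDG hd)
      have h2 : f c.1 ≤ (c.2 : EReal) := hCf hc
      have h3 := (EReal.sub_le_sub le_rfl h2).trans h1
      rw [← EReal.coe_sub, EReal.coe_le_coe_iff] at h3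
      dsimp only
      linarith)
    (by
      rintro _ ⟨c, hc, d, hd, rfl⟩
      obtain ⟨t, ht, c', hc', d', hd', h⟩ := habs c hc d hd
      exact ⟨t, ht, _, ⟨c', hc', d', hd', rfl⟩, h⟩)
  set b : X := (InnerProductSpace.toDual ℝ X).symm (LinearMap.toContinuousLinearMap a) with hb
  have hba : ∀ y, inner ℝ b y = a y := fun y => by
    rw [hb, InnerProductSpace.toDual_symm_apply]; rfl
  refine ⟨b + w, -b, by abel, conj_add_supportFun_le hp hGne ?_⟩
  have hCD : ∀ c ∈ C, ∀ d ∈ D, inner ℝ (b + w) c.1 - c.2 + inner ℝ (-b) d ≤ r := by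
    intro c hc d hd
    have := ha _ ⟨c, hc, d, hd, rfl⟩
    dsimp only at this
    rw [← hba, inner_sub_right] at this
    rw [inner_add_left, inner_neg_left]
    linarith
  -- The inequality is closed in `(q, z)`, so it passes from `C ×ˢ D` to its closure, which contains
  -- `epi f ×ˢ G`.
  intro q hq z hz
  have hclosed : IsClosed {y : (X × ℝ) × X |
      inner ℝ (b + w) y.1.1 - y.1.2 + inner ℝ (-b) y.2 ≤ r} :=
    isClosed_le (by fun_prop) continuous_const
  have hsub : closure (C ×ˢ D) ⊆ _ := closure_minimal (fun y hy => hCD _ hy.1 _ hy.2) hclosed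
  rw [closure_prod_eq] at hsub
  exact hsub (Set.mk_mem_prod (hfC hq) (hGD hz))

/-! ### The conjugate of the optimal value function -/

theorem coe_sub_le_comm {c : ℝ} {a s : EReal} : (c : EReal) - a ≤ s ↔ (c : EReal) - s ≤ a := by
  induction a <;> induction s <;> simp [← EReal.coe_sub, add_comm]

/-- The conjugate of the optimal value function as a supremum over the graph. -/
theorem conj_optVal {n p : ℕ} (f : RnRp n p → EReal) (F : Rn n → Set (Rn p)) (w : Rn n) :
    conj (optVal f F) w =
      ⨆ z ∈ gph F, ((inner ℝ (pair w (0 : Rn p)) z : ℝ) : EReal) - f z := by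
  have hin : ∀ z : RnRp n p, inner ℝ (pair w (0 : Rn p)) z = inner ℝ w z.fst := fun z => by
    simp [WithLp.prod_inner_apply]
  apply le_antisymm
  · refine iSup_le fun x => ?_
    rw [coe_sub_le_comm]
    refine le_iInf₂ fun y hy => ?_
    rw [← coe_sub_le_comm]
    refine le_trans (le_of_eq ?_) (le_iSup₂ (f := fun z (_ : z ∈ gph F) =>
      ((inner ℝ (pair w (0 : Rn p)) z : ℝ) : EReal) - f z) (pair x y) hy)
    rw [hin]; rfl
  · refine iSup₂_le fun z hz => ?_
    refine le_trans ?_ (le_iSup (fun x : Rn n => ((inner ℝ w x : ℝ) : EReal) - optVal f F x) z.fst)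
    rw [hin]
    exact EReal.sub_le_sub le_rfl (iInf₂_le (f := fun y (_ : y ∈ F z.fst) => f (pair z.fst y))
      z.snd hz)

/-- Weak duality. -/
theorem conj_optVal_le {n p : ℕ} {f : RnRp n p → EReal} {F : Rn n → Set (Rn p)}
    {w : Rn n} {a b : RnRp n p} (hab : a + b = pair w 0) :
    conj (optVal f F) w ≤ conj f a + mapConj F b := by
  rw [conj_optVal]
  refine iSup₂_le fun z hz => ?_
  have h1 : ((inner ℝ a z : ℝ) : EReal) - f z ≤ conj f a :=
    le_iSup (fun x => ((inner ℝ a x : ℝ) : EReal) - f x) z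
  have h2 : ((inner ℝ b z : ℝ) : EReal) ≤ mapConj F b :=
    le_iSup₂ (f := fun x (_ : x ∈ gph F) => ((inner ℝ b x : ℝ) : EReal)) z hz
  refine le_trans (le_of_eq ?_) (add_le_add h1 h2)
  rw [← hab, inner_add_left, EReal.coe_add, sub_eq_add_neg, sub_eq_add_neg, add_right_comm]

end NearConvexity

open NearConvexity in
theorem exists_conj_optVal_eq {n p : ℕ} {f : RnRp n p → EReal} {F : Rn n → Set (Rn p)}
    (hf_proper : ProperFun f) (hf : NearlyConvexFun f) (hF : NearlyConvexMap F)
    (hqc : (intrinsicInterior ℝ (effDom f) ∩ intrinsicInterior ℝ (gph F)).Nonempty)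
    {w : Rn n} {r : ℝ} (hr : conj (optVal f F) w = (r : EReal)) :
    ∃ a b : RnRp n p, a + b = pair w 0 ∧
      conj (optVal f F) w = conj f a + mapConj F b := by
  obtain ⟨a, b, hab, h⟩ := exists_conj_add_supportFun_le (w := pair w 0) (r := r) hf_proper hf hF
    hqc fun z hz => by
      rw [← hr, conj_optVal]
      exact le_iSup₂ (f := fun z (_ : z ∈ gph F) =>
        ((inner ℝ (pair w (0 : Rn p)) z : ℝ) : EReal) - f z) z hz
  exact ⟨a, b, hab, le_antisymm (conj_optVal_le hab) (hr ▸ h)⟩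

theorem theorem6p3 {n p : ℕ}
    (f : NearConvexity.RnRp n p → EReal)
    (F : NearConvexity.Rn n → Set (NearConvexity.Rn p))
    (hf_proper : NearConvexity.ProperFun f)
    (hf : NearConvexity.NearlyConvexFun f)
    (hF : NearConvexity.NearlyConvexMap F)
    (hqc : (intrinsicInterior ℝ (NearConvexity.effDom f) ∩
      intrinsicInterior ℝ (NearConvexity.gph F)).Nonempty) :
    (∀ w : NearConvexity.Rn n,
      NearConvexity.conj (NearConvexity.optVal f F) w =
        NearConvexity.infConv (NearConvexity.conj f) (NearConvexity.mapConj F)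
          (NearConvexity.pair w 0)) ∧
    (∀ w : NearConvexity.Rn n,
      (∃ r : ℝ, NearConvexity.conj (NearConvexity.optVal f F) w = (r : EReal)) →
      ∃ (w₁ w₂ : NearConvexity.Rn n) (v : NearConvexity.Rn p), w₁ + w₂ = w ∧
        NearConvexity.conj (NearConvexity.optVal f F) w =
          NearConvexity.conj f (NearConvexity.pair w₁ v) +
            NearConvexity.mapConj F (NearConvexity.pair w₂ (-v))) := by
  open NearConvexity in
  constructor
  · intro w
    apply le_antisymm
    · refine le_sInf ?_
      rintro _ ⟨a, b, hab, rfl⟩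
      exact conj_optVal_le hab
    · by_cases htop : conj (optVal f F) w = ⊤
      · rw [htop]; exact le_top
      -- The common point of `dom f` and `gph F` contributes a finite term to the supremum.
      have hbot : conj (optVal f F) w ≠ ⊥ := by
        obtain ⟨z, hzf, hzG⟩ := hqc
        have hz' : z ∈ effDom f := intrinsicInterior_subset hzf
        have hz : f z < ⊤ := hz'
        rw [conj_optVal]
        refine (lt_of_lt_of_le ?_ (le_iSup₂ (f := fun z (_ : z ∈ gph F) =>
          ((inner ℝ (pair w (0 : Rn p)) z : ℝ) : EReal) - f z) z
          (intrinsicInterior_subset hzG))).ne'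
        have := (hf_proper.2 z).ne'
        lift f z to ℝ using ⟨hz.ne, this⟩ with c
        exact EReal.bot_lt_coe (_ - c)
      obtain ⟨a, b, hab, h⟩ := exists_conj_optVal_eq hf_proper hf hF hqc
        (EReal.coe_toReal htop hbot).symm
      exact sInf_le ⟨a, b, hab, h⟩
  · rintro w ⟨r, hr⟩
    obtain ⟨a, b, hab, h⟩ := exists_conj_optVal_eq hf_proper hf hF hqc hr
    have h1 : a.fst + b.fst = w := congrArg (fun z : RnRp n p => z.fst) hab
    have h2 : a.snd + b.snd = 0 := congrArg (fun z : RnRp n p => z.snd) hab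
    refine ⟨a.fst, b.fst, a.snd, h1, ?_⟩
    rw [← eq_neg_of_add_eq_zero_right h2]
    exact h
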